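/- A length function on a group $G$ is a map $l:G\to\mathbb{R}_{\ge 0}$ with $l(e)=0$, $l(g^{-1})=l(g)$ and $l(gh)\le l(g)+l(h)$ for all $g,h\in G$. A function $f:\mathbb{N}\to\mathbb{R}_{\ge0}$ is subexponential if $\lim_{n\to\infty} f(n)^{1/n}=1$. A countable group $G$ has property SD (subexponential decay) with respect to a length function $l$, with decay function $f$, if $f$ is subexponential and for every $D\in\mathbb{N}$ and every $x\in\mathbb{C}[G]$ supported on $\{g\in G: l(g)\le D\}$ one has $\|x\|\le f(D)\,\|x\|_2$. Here $\|x\|$ is the norm of $x$ acting on $\ell^2(G)$ through the left regular representation, and $\|x\|_2=\big(\sum_{g}|x_g|^2\big)^{1/2}$. **Lemma.** Let $G$ and $H$ be countable groups that have property SD with respect to length functions $l_G$ and $l_H$, with decay functions $f_G$ and $f_H$ respectively. Put $$f(x)=(2x+1)^{7/2}\max(f_G(x),f_H(x)),\qquad x\in\mathbb{N}.$$ 1. The free product $G*H$ has property SD, with decay function $f$, with respect to some length function on $G*H$. 2. If $l_G(g)\ge 1$ for all $g\in G\setminus\{e\}$ and $l_H(h)\ge 1$ for all $h\in H\setminus\{e\}$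 (for instance, if both length functions are integer-valued and vanish only at the identity), then $G*H$ has property SD, with decay function $f$, with respect to the natural free-product length $$l_{G*H}(s_1s_2\cdots s_n)=\sum_{i=1}^n l(s_i),\qquad s_1s_2\cdots s_n \text{ a reduced word},$$ that is, the letters $s_i$ are non-identity elements taken alternately from $G$ and $H$, and $l(s_i)$ means $l_G(s_i)$ or $l_H(s_i)$ according to the factor containing $s_i$. -/

import Mathlib

open scoped NNReal

namespace SubexpDecay

universe u v

section Analysis

variable {G : Type u} [Group G]

/-- A length function on a group. -/
structure IsLength (l : G → ℝ≥0) : Prop where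
  map_one : l 1 = 0
  map_inv : ∀ g, l g⁻¹ = l g
  map_mul_le : ∀ g h, l (g * h) ≤ l g + l h

/-- A function `f : ℕ → ℝ≥0` is subexponential if `f n ^ (1 / n) → 1`. -/
def IsSubexp (f : ℕ → ℝ≥0) : Prop :=
  Filter.Tendsto (fun n : ℕ => f n ^ (1 / (n : ℝ))) Filter.atTop (nhds 1)

variable (G) in
/-- The Hilbert space `ℓ²(G)`. -/
abbrev Ell2 : Type u := lp (fun _ : G => ℂ) 2

theorem memlp_translate (g : G) (ξ : Ell2 G) :
    Memℓp (fun h : G => (ξ : G → ℂ) (g⁻¹ * h)) 2 := by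
  have h2 : 0 < (2 : ENNReal).toReal := by norm_num
  exact (memℓp_gen_iff h2).2
    ((Equiv.summable_iff (Equiv.mulLeft g⁻¹)).2 ((memℓp_gen_iff h2).1 (lp.memℓp ξ)))

/-- Left translation by `g` on `ℓ²(G)`: `(λ(g) ξ)(h) = ξ(g⁻¹ h)`. -/
noncomputable def translate (g : G) : Ell2 G →ₗᵢ[ℂ] Ell2 G where
  toFun ξ := ⟨fun h => (ξ : G → ℂ) (g⁻¹ * h), memlp_translate g ξ⟩
  map_add' _ _ := rfl
  map_smul' _ _ := rfl
  norm_map' ξ := by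
    have h2 : 0 < (2 : ENNReal).toReal := by norm_num
    rw [lp.norm_eq_tsum_rpow h2, lp.norm_eq_tsum_rpow h2]
    congr 1
    exact (Equiv.mulLeft g⁻¹).tsum_eq (fun h => ‖(ξ : G → ℂ) h‖ ^ (2 : ENNReal).toReal)

@[simp] theorem translate_apply (g : G) (ξ : Ell2 G) (h : G) :
    (translate g ξ : G → ℂ) h = (ξ : G → ℂ) (g⁻¹ * h) := rfl

/-- The left regular representation `g ↦ λ(g)` by bounded operators on `ℓ²(G)`. -/
noncomputable def leftRegular : G →* (Ell2 G →L[ℂ] Ell2 G) where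
  toFun g := (translate g).toContinuousLinearMap
  map_one' := by
    ext ξ h
    simp
  map_mul' g₁ g₂ := by
    ext ξ h
    simp [mul_assoc]

/-- The left regular representation `ℂ[G] → B(ℓ²(G))`, `∑ x_g g ↦ ∑ x_g λ(g)`. -/
noncomputable def regularRep : MonoidAlgebra ℂ G →ₐ[ℂ] (Ell2 G →L[ℂ] Ell2 G) :=
  MonoidAlgebra.lift ℂ (Ell2 G →L[ℂ] Ell2 G) G leftRegular

/-- The reduced operator norm `‖x‖` of an element `x` of `ℂ[G]`. -/
noncomputable def opNorm (x : MonoidAlgebra ℂ G) : ℝ := ‖regularRep x‖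

/-- The norm `‖x‖₂ = (∑ |x_g|²)^{1/2}` of an element `x` of `ℂ[G]`. -/
noncomputable def twoNorm (x : MonoidAlgebra ℂ G) : ℝ :=
  Real.sqrt (∑ g ∈ x.coeff.support, ‖x.coeff g‖ ^ 2)

/-- The countable group `G` has subexponential decay with respect to the length function `l`,
with decay function `f`. -/
structure HasSD (l : G → ℝ≥0) (f : ℕ → ℝ≥0) : Prop where
  countable : Countable G
  isLength : IsLength l
  isSubexp : IsSubexp f
  decay : ∀ (D : ℕ) (x : MonoidAlgebra ℂ G),
    (∀ g ∈ x.coeff.support, l g ≤ D) → opNorm x ≤ f D * twoNorm x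

end Analysis

section FreeProduct

/-- The two factors as a family indexed by `Bool`, in a common universe. -/
abbrev Fam (G : Type u) (H : Type v) (b : Bool) : Type (max u v) :=
  Bool.rec (ULift.{u} H) (ULift.{v} G) b

/-- A letter as an element of the family. -/
def letter {G : Type u} {H : Type v} : G ⊕ H → Σ b, Fam G H b :=
  Sum.elim (fun g => ⟨true, ULift.up g⟩) (fun h => ⟨false, ULift.up h⟩)

theorem letter_injective {G : Type u} {H : Type v} : Function.Injective (letter : G ⊕ H → Σ b, Fam G H b) := by
  rintro (g | h) (g' | h') e
  · simpa [letter] using e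
  · simp [letter] at e
  · simp [letter] at e
  · simpa [letter] using e

open Monoid.Coprod

variable {G : Type u} {H : Type v} [Group G] [Group H]

/-- A word in the letters of `G` and `H` is reduced if no letter is an identity element and
adjacent letters come from different factors. -/
def IsReduced (w : List (G ⊕ H)) : Prop :=
  (∀ s ∈ w, s ≠ Sum.inl 1 ∧ s ≠ Sum.inr 1) ∧ w.IsChain (fun s t => s.isLeft ≠ t.isLeft)

/-- The element of the free product `G * H` that a word represents. -/
def wordProd (w : List (G ⊕ H)) : Monoid.Coprod G H :=
  (w.map (Sum.elim (fun g => inl g) (fun h => inr h))).prod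

theorem exists_reduced (x : Monoid.Coprod G H) :
    ∃ w : List (G ⊕ H), IsReduced w ∧ wordProd w = x := by
  induction x using Monoid.Coprod.induction_on' with
  | one => exact ⟨[], ⟨by simp, by simp⟩, rfl⟩
  | inl_mul g x ih =>
    obtain ⟨w, ⟨hw1, hw2⟩, rfl⟩ := ih
    by_cases hg : g = 1
    · exact ⟨w, ⟨hw1, hw2⟩, by simp [hg]⟩
    rcases w with _ | ⟨a | b, w⟩
    · exact ⟨[Sum.inl g], ⟨by simpa using hg, by simp⟩, by simp [wordProd]⟩
    · by_cases hga : g * a = 1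
      · refine ⟨w, ⟨fun s hs => hw1 s (by simp [hs]), hw2.tail⟩, ?_⟩
        simp [wordProd, ← mul_assoc, ← map_mul, hga]
      · refine ⟨Sum.inl (g * a) :: w, ⟨?_, ?_⟩, by simp [wordProd, mul_assoc]⟩
        · intro s hs
          rcases List.mem_cons.1 hs with rfl | hs
          · simpa using hga
          · exact hw1 s (by simp [hs])
        · rcases w with _ | ⟨c, w⟩
          · simp
          · simpa using hw2
    · refine ⟨Sum.inl g :: Sum.inr b :: w, ⟨?_, ?_⟩, by simp [wordProd]⟩
      · intro s hs
        rcases List.mem_cons.1 hs with rfl | hs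
        · simpa using hg
        · exact hw1 s hs
      · simpa using hw2
  | inr_mul g x ih =>
    obtain ⟨w, ⟨hw1, hw2⟩, rfl⟩ := ih
    by_cases hg : g = 1
    · exact ⟨w, ⟨hw1, hw2⟩, by simp [hg]⟩
    rcases w with _ | ⟨b | a, w⟩
    · exact ⟨[Sum.inr g], ⟨by simpa using hg, by simp⟩, by simp [wordProd]⟩
    · refine ⟨Sum.inr g :: Sum.inl b :: w, ⟨?_, ?_⟩, by simp [wordProd]⟩
      · intro s hs
        rcases List.mem_cons.1 hs with rfl | hs
        · simpa using hg
        · exact hw1 s hs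
      · simpa using hw2
    · by_cases hga : g * a = 1
      · refine ⟨w, ⟨fun s hs => hw1 s (by simp [hs]), hw2.tail⟩, ?_⟩
        simp [wordProd, ← mul_assoc, ← map_mul, hga]
      · refine ⟨Sum.inr (g * a) :: w, ⟨?_, ?_⟩, by simp [wordProd, mul_assoc]⟩
        · intro s hs
          rcases List.mem_cons.1 hs with rfl | hs
          · simpa using hga
          · exact hw1 s (by simp [hs])
        · rcases w with _ | ⟨c, w⟩
          · simp
          · simpa using hw2

/-- The reduced word of an element of `G * H`. -/
noncomputable def reducedWord (x : Monoid.Coprod G H) : List (G ⊕ H) :=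
  (exists_reduced x).choose

theorem reducedWord_spec (x : Monoid.Coprod G H) :
    IsReduced (reducedWord x) ∧ wordProd (reducedWord x) = x :=
  (exists_reduced x).choose_spec

/-- The natural length on `G * H`: the sum of the lengths of the letters of the reduced word. -/
noncomputable def freeProductLength (lG : G → ℝ≥0) (lH : H → ℝ≥0) (x : Monoid.Coprod G H) : ℝ≥0 :=
  ((reducedWord x).map (Sum.elim lG lH)).sum

instance famGroup (b : Bool) : Group (Fam G H b) := by
  cases b
  · exact inferInstanceAs (Group (ULift.{u} H))
  · exact inferInstanceAs (Group (ULift.{v} G))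

/-- The comparison of the binary free product with the free product of the family. -/
def toCoprodI : Monoid.Coprod G H →* Monoid.CoprodI (Fam G H) :=
  Monoid.Coprod.lift
    ((Monoid.CoprodI.of (M := Fam G H) (i := true)).comp (MulEquiv.ulift.symm.toMonoidHom))
    ((Monoid.CoprodI.of (M := Fam G H) (i := false)).comp (MulEquiv.ulift.symm.toMonoidHom))

/-- Reduced words are determined by the elements they represent. -/
theorem reduced_unique {w w' : List (G ⊕ H)} (hw : IsReduced w) (hw' : IsReduced w')
    (h : wordProd w = wordProd w') : w = w' := by
  classical
  have key : ∀ w : List (G ⊕ H), IsReduced w → ∃ W : Monoid.CoprodI.Word (Fam G H),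
      W.toList = w.map letter ∧ W.prod = toCoprodI (wordProd w) := by
    intro w hw
    refine ⟨⟨w.map letter, ?_, ?_⟩, rfl, ?_⟩
    · intro l hl
      obtain ⟨s, hs, rfl⟩ := List.mem_map.1 hl
      have := hw.1 s hs
      rcases s with g | h
      · intro e
        exact this.1 (congrArg Sum.inl (congrArg ULift.down e))
      · intro e
        exact this.2 (congrArg Sum.inr (congrArg ULift.down e))
    · rw [List.isChain_map]
      refine hw.2.imp ?_
      rintro (_ | _) (_ | _) <;> simp [letter]
    · simp only [Monoid.CoprodI.Word.prod, wordProd, map_list_prod, List.map_map]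
      congr 1
      apply List.map_congr_left
      rintro (g | h) _ <;> rfl
  obtain ⟨W, hW, hWp⟩ := key w hw
  obtain ⟨W', hW', hWp'⟩ := key w' hw'
  have : W = W' := Monoid.CoprodI.Word.equiv.symm.injective
    (show W.prod = W'.prod by rw [hWp, hWp', h])
  exact List.map_injective_iff.2 letter_injective (by rw [← hW, ← hW', this])

theorem freeProductLength_wordProd (lG : G → ℝ≥0) (lH : H → ℝ≥0) {w : List (G ⊕ H)}
    (hw : IsReduced w) : freeProductLength lG lH (wordProd w) = (w.map (Sum.elim lG lH)).sum := by
  have h := reducedWord_spec (wordProd w)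
  rw [freeProductLength, reduced_unique h.1 hw h.2]

end FreeProduct

end SubexpDecay

/-!
Let `x` be supported on the ball of radius `D` of `G * H`. The norm of `x` is controlled by the
sums `∑ X g * Y h * Z (g * h)` with `X = |x|` and `Y, Z ≥ 0` in `ℓ²`. Cancelling as far as possible
writes the reduced words of `g`, `h` and `g * h` as `a p b`, `b⁻¹ q c` and `a r c`, where either
`p`, `q`, `r` are empty or they are letters of the same factor with `p * q = r`. For fixed
`a, b, c` the sum over the letters `p`, `q` is a convolution in that factor, which its decay
function bounds; what remains is a sum `∑ A (a, b) * B (b, c) * E (a, c)`, bounded by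
`‖A‖₂ ‖B‖₂ ‖E‖₂` by Cauchy–Schwarz. Since letters have length at least `1`, `a` and `b` have at
most `D` letters, so each of the three functions repeats each value at most `D + 1` times (`D`
times if there is a letter `p` in between), which makes a factor `(D + 1) ^ (3 / 2)` or
`D ^ (3 / 2)`. Lengths that are smaller than `1` off the identity are first replaced by
`max l 1`.
-/

namespace SubexpDecay

open scoped ENNReal

section L2Norm

variable {α β γ : Type*}

/-- The `ℓ²`-norm of a function with values in `[0, ∞]`. Working in `[0, ∞]` keeps all the sums
below free of summability conditions. -/
noncomputable def l2norm (u : α → ℝ≥0∞) : ℝ≥0∞ := (∑' a, u a ^ 2) ^ (1 / 2 : ℝ)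

theorem l2norm_sq (u : α → ℝ≥0∞) : l2norm u ^ 2 = ∑' a, u a ^ 2 := by
  rw [l2norm, ← ENNReal.rpow_natCast, ← ENNReal.rpow_mul]
  norm_num

theorem le_l2norm (u : α → ℝ≥0∞) (a : α) : u a ≤ l2norm u := by
  rw [← ENNReal.pow_le_pow_left_iff two_ne_zero, l2norm_sq]
  exact ENNReal.le_tsum a

@[gcongr]
theorem l2norm_mono {u v : α → ℝ≥0∞} (h : ∀ a, u a ≤ v a) : l2norm u ≤ l2norm v := by
  unfold l2norm
  gcongr with a
  exact h a

theorem l2norm_comp_equiv (e : α ≃ β) (u : β → ℝ≥0∞) : l2norm (fun a => u (e a)) = l2norm u := by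
  rw [l2norm, l2norm, e.tsum_eq (fun b => u b ^ 2)]

theorem l2norm_prod_mul (u : α → ℝ≥0∞) (v : β → ℝ≥0∞) :
    l2norm (fun p : α × β => u p.1 * v p.2) = l2norm u * l2norm v := by
  rw [l2norm, l2norm, l2norm, ← ENNReal.mul_rpow_of_nonneg _ _ (by norm_num), ENNReal.tsum_prod']
  simp_rw [mul_pow, ENNReal.tsum_mul_left, ENNReal.tsum_mul_right]

theorem l2norm_l2norm (u : α × β → ℝ≥0∞) :
    l2norm (fun a => l2norm fun b => u (a, b)) = l2norm u := by
  rw [l2norm, l2norm, ENNReal.tsum_prod']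
  simp_rw [l2norm_sq]

theorem l2norm_indicator_comp_le_of_injOn {s : Set α} {i : α → β} (hi : s.InjOn i)
    (u : β → ℝ≥0∞) : l2norm (s.indicator (u ∘ i)) ≤ l2norm u := by
  rw [← ENNReal.pow_le_pow_left_iff two_ne_zero, l2norm_sq, l2norm_sq]
  calc ∑' a, s.indicator (u ∘ i) a ^ 2
      = ∑' a : s, u (i a) ^ 2 := by
        rw [tsum_subtype s fun a => u (i a) ^ 2]
        exact tsum_congr fun a => by by_cases ha : a ∈ s <;> simp [ha]
    _ ≤ ∑' b, u b ^ 2 :=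
        ENNReal.tsum_comp_le_tsum_of_injective hi.injective fun b => u b ^ 2

theorem l2norm_indicator_comp_le (i : α → β) (k : α → ℕ)
    (hinj : Function.Injective fun a => (k a, i a)) (N : ℕ) (u : β → ℝ≥0∞) :
    l2norm ({a | k a < N}.indicator (u ∘ i)) ≤ (N : ℝ≥0∞) ^ (1 / 2 : ℝ) * l2norm u := by
  have split_levels (a : α) : {a | k a < N}.indicator (u ∘ i) a ^ 2
      = ∑ n ∈ Finset.range N, {a | k a = n}.indicator (u ∘ i) a ^ 2 := by
    have level (n : ℕ) : {a | k a = n}.indicator (u ∘ i) a ^ 2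
        = if k a = n then u (i a) ^ 2 else 0 := by
      by_cases h : k a = n <;> simp [h]
    simp_rw [level, Finset.sum_ite_eq, Finset.mem_range]
    by_cases h : k a < N <;> simp [h]
  have level_le (n : ℕ) : ∑' a, {a | k a = n}.indicator (u ∘ i) a ^ 2 ≤ ∑' b, u b ^ 2 := by
    rw [← l2norm_sq, ← l2norm_sq]
    gcongr
    refine l2norm_indicator_comp_le_of_injOn (fun a ha b hb hab => hinj ?_) u
    exact Prod.ext (ha.trans hb.symm) hab
  rw [l2norm, l2norm, ← ENNReal.mul_rpow_of_nonneg _ _ (by norm_num)]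
  gcongr
  simp_rw [split_levels]
  rw [Summable.tsum_finsetSum fun _ _ => ENNReal.summable]
  calc ∑ n ∈ Finset.range N, ∑' a, {a | k a = n}.indicator (u ∘ i) a ^ 2
      ≤ ∑ _n ∈ Finset.range N, ∑' b, u b ^ 2 := Finset.sum_le_sum fun n _ => level_le n
    _ = N * ∑' b, u b ^ 2 := by simp

theorem tsum_mul_le_l2norm_mul_l2norm (u v : α → ℝ≥0∞) :
    ∑' a, u a * v a ≤ l2norm u * l2norm v := by
  rw [ENNReal.tsum_eq_iSup_sum]
  refine iSup_le fun s => ?_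
  calc ∑ a ∈ s, u a * v a
      ≤ (∑ a ∈ s, u a ^ (2 : ℝ)) ^ (1 / 2 : ℝ) * (∑ a ∈ s, v a ^ (2 : ℝ)) ^ (1 / 2 : ℝ) :=
        ENNReal.inner_le_Lp_mul_Lq s u v .two_two
    _ ≤ l2norm u * l2norm v := by
        simp only [ENNReal.rpow_ofNat, l2norm]
        gcongr <;> exact ENNReal.sum_le_tsum s

theorem tsum_triangle_le (A : α × β → ℝ≥0∞) (B : β × γ → ℝ≥0∞) (E : α × γ → ℝ≥0∞) :
    ∑' (a) (b) (c), A (a, b) * B (b, c) * E (a, c) ≤ l2norm A * l2norm B * l2norm E := by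
  have l2norm_columns : l2norm (fun c => l2norm fun b => B (b, c)) = l2norm B :=
    (l2norm_l2norm fun p : γ × β => B (p.2, p.1)).trans (l2norm_comp_equiv (Equiv.prodComm γ β) B)
  calc ∑' (a) (b) (c), A (a, b) * B (b, c) * E (a, c)
      = ∑' p : α × γ, (∑' b, A (p.1, b) * B (b, p.2)) * E p := by
        rw [ENNReal.tsum_prod']
        refine tsum_congr fun a => ?_
        rw [ENNReal.tsum_comm]
        exact tsum_congr fun c => ENNReal.tsum_mul_right
    _ ≤ ∑' p : α × γ, (l2norm (fun b => A (p.1, b)) * l2norm (fun b => B (b, p.2))) * E p := by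
        gcongr
        exact tsum_mul_le_l2norm_mul_l2norm _ _
    _ ≤ l2norm (fun p : α × γ => l2norm (fun b => A (p.1, b)) * l2norm (fun b => B (b, p.2)))
          * l2norm E := tsum_mul_le_l2norm_mul_l2norm _ _
    _ = l2norm A * l2norm B * l2norm E := by
        rw [l2norm_prod_mul (fun a => l2norm fun b => A (a, b)) fun c => l2norm fun b => B (b, c),
          l2norm_l2norm, l2norm_columns]

theorem enorm_eq_l2norm (ξ : Ell2 α) : ‖ξ‖ₑ = l2norm fun a => ‖(ξ : α → ℂ) a‖ₑ := by
  have h2 : 0 < (2 : ℝ≥0∞).toReal := by norm_num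
  rw [l2norm, ← ofReal_norm, lp.norm_eq_tsum_rpow h2,
    ← ENNReal.ofReal_rpow_of_nonneg (tsum_nonneg fun _ => by positivity) (by norm_num),
    ENNReal.ofReal_tsum_of_nonneg (fun _ => by positivity) (lp.hasSum_norm h2 ξ).summable]
  simp only [ENNReal.toReal_ofNat, Real.rpow_ofNat, ENNReal.ofReal_pow (norm_nonneg _), ofReal_norm]

theorem exists_coe_eq_of_l2norm_ne_top {u : α → ℝ≥0} (hu : l2norm (fun a => (u a : ℝ≥0∞)) ≠ ∞) :
    ∃ ξ : Ell2 α, ∀ a, (ξ : α → ℂ) a = u a := by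
  have sum_ne_top : ∑' a, ((u a ^ 2 : ℝ≥0) : ℝ≥0∞) ≠ ∞ := by
    simpa only [l2norm_sq, ENNReal.coe_pow] using ENNReal.pow_ne_top hu (n := 2)
  have hmem : Memℓp (fun a => (u a : ℂ)) 2 := by
    rw [memℓp_gen_iff (by norm_num)]
    simpa using NNReal.summable_coe.2 (ENNReal.tsum_coe_ne_top_iff_summable.1 sum_ne_top)
  exact ⟨⟨_, hmem⟩, fun _ => rfl⟩

theorem enorm_twoNorm (x : MonoidAlgebra ℂ α) :
    ‖twoNorm x‖ₑ = l2norm fun a => ‖x.coeff a‖ₑ := by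
  rw [l2norm, twoNorm, Real.enorm_eq_ofReal (Real.sqrt_nonneg _), Real.sqrt_eq_rpow,
    ← ENNReal.ofReal_rpow_of_nonneg (by positivity) (by norm_num),
    ENNReal.ofReal_sum_of_nonneg (fun _ _ => by positivity), tsum_eq_sum (s := x.coeff.support)]
  · simp only [ENNReal.ofReal_pow (norm_nonneg _), ofReal_norm]
  · intro a ha
    simp [Finsupp.notMem_support_iff.1 ha]

theorem twoNorm_nonneg (x : MonoidAlgebra ℂ α) : 0 ≤ twoNorm x := Real.sqrt_nonneg _

theorem twoNorm_single_one (a : α) : twoNorm (MonoidAlgebra.single a (1 : ℂ)) = 1 := by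
  simp [twoNorm, Finsupp.support_single]

end L2Norm

section Convolution

variable {G : Type*} [Group G]

theorem regularRep_apply (x : MonoidAlgebra ℂ G) (ξ : Ell2 G) (k : G) :
    (regularRep x ξ : G → ℂ) k = ∑ g ∈ x.coeff.support, x.coeff g * (ξ : G → ℂ) (g⁻¹ * k) := by
  rw [regularRep, MonoidAlgebra.lift_apply, Finsupp.sum, sum_apply, lp.coeFn_sum, Finset.sum_apply]
  rfl

theorem enorm_regularRep_apply_le (x : MonoidAlgebra ℂ G) (ξ : Ell2 G) (k : G) :
    ‖(regularRep x ξ : G → ℂ) k‖ₑ ≤ ∑' g, ‖x.coeff g‖ₑ * ‖(ξ : G → ℂ) (g⁻¹ * k)‖ₑ := by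
  rw [regularRep_apply]
  refine (enorm_sum_le _ _).trans ?_
  simp_rw [enorm_mul]
  exact ENNReal.sum_le_tsum _

theorem opNorm_single_one (g : G) : opNorm (MonoidAlgebra.single g (1 : ℂ)) = 1 := by
  classical
  have : Nontrivial (Ell2 G) := ⟨lp.single 2 1 1, 0, fun h => by
    simpa using congrArg (fun ξ : Ell2 G => (ξ : G → ℂ) 1) h⟩
  rw [opNorm, regularRep, MonoidAlgebra.lift_single, one_smul]
  exact (translate g).norm_toContinuousLinearMap

theorem tsum_tsum_mul_eq_tsum_convolution_mul (X Y Z : G → ℝ≥0∞) :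
    ∑' (s) (t), X s * Y t * Z (s * t) = ∑' k, (∑' s, X s * Y (s⁻¹ * k)) * Z k := by
  simp_rw [← ENNReal.tsum_mul_right]
  conv_rhs => rw [ENNReal.tsum_comm]
  refine tsum_congr fun s => ?_
  rw [← (Equiv.mulLeft s).tsum_eq fun k => X s * Y (s⁻¹ * k) * Z k]
  simp only [Equiv.coe_mulLeft, inv_mul_cancel_left]

/-- Left convolution by nonnegative functions supported in `K` has norm at most `C` on `ℓ²(G)`.
The bound on `‖X * Y‖₂` is tested against a third function `Z`, which makes it symmetric enough to
be used on the matching triples of a free product. -/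
def ConvolutionBound (K : Set G) (C : ℝ≥0∞) : Prop :=
  ∀ X Y Z : G → ℝ≥0∞, Function.support X ⊆ K →
    ∑' (s) (t), X s * Y t * Z (s * t) ≤ C * (l2norm X * l2norm Y * l2norm Z)

variable {K : Set G}

theorem ConvolutionBound.mono {K' : Set G} {C C' : ℝ≥0∞} (h : ConvolutionBound K C) (hK : K' ⊆ K)
    (hC : C ≤ C') : ConvolutionBound K' C' := fun X Y Z hX =>
  (h X Y Z (hX.trans hK)).trans (mul_le_mul' hC le_rfl)

theorem convolutionBound_univ_of_subsingleton [Subsingleton G] :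
    ConvolutionBound (Set.univ : Set G) 1 := by
  intro X Y Z _
  have tsum_eq (u : G → ℝ≥0∞) : ∑' g, u g = u 1 :=
    tsum_eq_single 1 fun g hg => absurd (Subsingleton.elim g 1) hg
  have l2norm_eq (u : G → ℝ≥0∞) : l2norm u = u 1 := by
    rw [l2norm, tsum_eq, ← ENNReal.rpow_natCast, ← ENNReal.rpow_mul]
    norm_num
  simp only [tsum_eq, l2norm_eq, mul_one, one_mul, le_refl]

theorem ConvolutionBound.opNorm_le {C : ℝ≥0} (h : ConvolutionBound K C) {x : MonoidAlgebra ℂ G}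
    (hx : ∀ g ∈ x.coeff.support, g ∈ K) : opNorm x ≤ C * twoNorm x := by
  have bound_nonneg : 0 ≤ C * twoNorm x := mul_nonneg C.2 (twoNorm_nonneg x)
  refine ContinuousLinearMap.opNorm_le_bound _ bound_nonneg fun ξ => ?_
  set η := regularRep x ξ
  rcases eq_or_ne η 0 with h0 | h0
  · rw [h0, norm_zero]
    exact mul_nonneg bound_nonneg (norm_nonneg ξ)
  have enorm_mul_enorm_le : ‖η‖ₑ * ‖η‖ₑ ≤ ‖C * twoNorm x * ‖ξ‖‖ₑ * ‖η‖ₑ := by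
    calc ‖η‖ₑ * ‖η‖ₑ = ∑' k, ‖(η : G → ℂ) k‖ₑ * ‖(η : G → ℂ) k‖ₑ := by
          simp_rw [enorm_eq_l2norm, ← sq, l2norm_sq]
      _ ≤ ∑' k, (∑' s, ‖x.coeff s‖ₑ * ‖(ξ : G → ℂ) (s⁻¹ * k)‖ₑ) * ‖(η : G → ℂ) k‖ₑ := by
          gcongr with k
          exact enorm_regularRep_apply_le x ξ k
      _ = ∑' (s) (t), ‖x.coeff s‖ₑ * ‖(ξ : G → ℂ) t‖ₑ * ‖(η : G → ℂ) (s * t)‖ₑ :=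
          (tsum_tsum_mul_eq_tsum_convolution_mul (fun s => ‖x.coeff s‖ₑ)
            (fun t => ‖(ξ : G → ℂ) t‖ₑ) fun k => ‖(η : G → ℂ) k‖ₑ).symm
      _ ≤ C * (‖twoNorm x‖ₑ * ‖ξ‖ₑ * ‖η‖ₑ) := by
          rw [enorm_twoNorm, enorm_eq_l2norm ξ, enorm_eq_l2norm η]
          exact h _ _ (fun k => ‖(η : G → ℂ) k‖ₑ) fun g hg => hx g (by simpa using hg)
      _ = ‖C * twoNorm x * ‖ξ‖‖ₑ * ‖η‖ₑ := by
          rw [enorm_mul, enorm_mul, NNReal.enorm_eq, enorm_norm]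
          ring
  rwa [ENNReal.mul_le_mul_iff_left (enorm_ne_zero.2 h0) enorm_ne_top, enorm_le_iff_norm_le,
    Real.norm_of_nonneg (mul_nonneg bound_nonneg (norm_nonneg ξ))] at enorm_mul_enorm_le

theorem tsum_tsum_mul_le_of_opNorm_le {C : ℝ≥0} {x : MonoidAlgebra ℂ G}
    (hx : opNorm x ≤ C * twoNorm x) {X Y : G → ℝ≥0} (hX : ∀ s, x.coeff s = X s)
    (hY : l2norm (fun t => (Y t : ℝ≥0∞)) ≠ ∞) (Z : G → ℝ≥0∞) :
    ∑' (s) (t), X s * Y t * Z (s * t)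
      ≤ C * (l2norm (fun s => (X s : ℝ≥0∞)) * l2norm (fun t => (Y t : ℝ≥0∞)) * l2norm Z) := by
  obtain ⟨ξ, hξ⟩ := exists_coe_eq_of_l2norm_ne_top hY
  have enorm_coe (r : ℝ≥0) : ‖(r : ℂ)‖ₑ = r := by
    rw [← ofReal_norm, Complex.norm_real, NNReal.norm_eq, ENNReal.ofReal_coe_nnreal]
  have convolution_eq (k : G) :
      ∑' s, (X s * Y (s⁻¹ * k) : ℝ≥0∞) = ‖(regularRep x ξ : G → ℂ) k‖ₑ := by
    have apply_eq_coe : (regularRep x ξ : G → ℂ) k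
        = ((∑ s ∈ x.coeff.support, X s * Y (s⁻¹ * k) : ℝ≥0) : ℂ) := by
      rw [regularRep_apply]
      push_cast
      simp_rw [hX, hξ]
    rw [apply_eq_coe, enorm_coe, tsum_eq_sum (s := x.coeff.support)]
    · push_cast
      rfl
    · intro s hs
      have : X s = 0 := by simpa [hX] using hs
      simp [this]
  have enorm_le : ‖regularRep x ξ‖ₑ
      ≤ C * (l2norm (fun s => (X s : ℝ≥0∞)) * l2norm (fun t => (Y t : ℝ≥0∞))) := by
    calc ‖regularRep x ξ‖ₑ ≤ ‖C * twoNorm x * ‖ξ‖‖ₑ := by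
          rw [enorm_le_iff_norm_le]
          refine ((regularRep x).le_of_opNorm_le hx ξ).trans (Real.le_norm_self _)
      _ = _ := by
          rw [enorm_mul, enorm_mul, NNReal.enorm_eq, enorm_norm, enorm_twoNorm, enorm_eq_l2norm]
          simp_rw [hX, hξ, enorm_coe, mul_assoc]
  calc ∑' (s) (t), (X s * Y t * Z (s * t) : ℝ≥0∞)
      = ∑' k, ‖(regularRep x ξ : G → ℂ) k‖ₑ * Z k := by
        rw [tsum_tsum_mul_eq_tsum_convolution_mul (fun s => X s) (fun t => Y t)]
        simp_rw [convolution_eq]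
    _ ≤ ‖regularRep x ξ‖ₑ * l2norm Z := by
        rw [enorm_eq_l2norm]
        exact tsum_mul_le_l2norm_mul_l2norm _ _
    _ ≤ _ := by
        rw [← mul_assoc]
        gcongr

theorem one_le_of_forall_opNorm_le {C : ℝ≥0} (hK : K.Nonempty)
    (h : ∀ x : MonoidAlgebra ℂ G, (∀ g ∈ x.coeff.support, g ∈ K) → opNorm x ≤ C * twoNorm x) :
    1 ≤ C := by
  obtain ⟨g, hg⟩ := hK
  have := h (.single g 1) fun k hk => by
    obtain ⟨rfl, -⟩ := Finsupp.mem_support_single _ _ _ |>.1 hk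
    exact hg
  rwa [opNorm_single_one, twoNorm_single_one, mul_one, NNReal.one_le_coe] at this

theorem tsum_tsum_mul_eq_zero {X Y Z : G → ℝ≥0∞} (h : l2norm X * l2norm Y * l2norm Z = 0) :
    ∑' (s) (t), X s * Y t * Z (s * t) = 0 := by
  have eq_zero {u : G → ℝ≥0∞} (hu : l2norm u = 0) (g : G) : u g = 0 :=
    le_zero_iff.1 (hu ▸ le_l2norm u g)
  rcases mul_eq_zero.1 h with h | h
  · rcases mul_eq_zero.1 h with h | h <;> simp [eq_zero h]
  · simp [eq_zero h]

theorem sum_tsum_mul_le_of_forall_opNorm_le {C : ℝ≥0}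
    (h : ∀ x : MonoidAlgebra ℂ G, (∀ g ∈ x.coeff.support, g ∈ K) → opNorm x ≤ C * twoNorm x)
    {X Y : G → ℝ≥0} (hXK : Function.support X ⊆ K) (hY : l2norm (fun t => (Y t : ℝ≥0∞)) ≠ ∞)
    (Z : G → ℝ≥0∞) (F : Finset G) :
    ∑ s ∈ F, ∑' t, X s * Y t * Z (s * t)
      ≤ C * (l2norm (fun s => (X s : ℝ≥0∞)) * l2norm (fun t => (Y t : ℝ≥0∞)) * l2norm Z) := by
  classical
  let XF : G → ℝ≥0 := (F : Set G).indicator X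
  let x : MonoidAlgebra ℂ G := .ofCoeff (.onFinset F (fun s => (XF s : ℂ)) fun s hs => by
    by_contra hsF
    simp [XF, hsF] at hs)
  have hx : ∀ g ∈ x.coeff.support, g ∈ K := fun g hg => hXK fun hXg => by
    simp_all [x, XF, Set.indicator_apply]
  calc ∑ s ∈ F, ∑' t, (X s * Y t * Z (s * t) : ℝ≥0∞)
      = ∑' (s) (t), (XF s * Y t * Z (s * t) : ℝ≥0∞) := by
        rw [tsum_eq_sum (s := F) fun s hs => by simp [XF, hs]]
        exact Finset.sum_congr rfl fun s hs => by simp [XF, hs]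
    _ ≤ C * (l2norm (fun s => (XF s : ℝ≥0∞)) * l2norm (fun t => (Y t : ℝ≥0∞)) * l2norm Z) :=
        tsum_tsum_mul_le_of_opNorm_le (h x hx) (fun _ => rfl) hY Z
    _ ≤ C * (l2norm (fun s => (X s : ℝ≥0∞)) * l2norm (fun t => (Y t : ℝ≥0∞)) * l2norm Z) := by
        gcongr with s
        exact Set.indicator_le_self _ _ s

theorem convolutionBound_of_forall_opNorm_le {C : ℝ≥0}
    (h : ∀ x : MonoidAlgebra ℂ G, (∀ g ∈ x.coeff.support, g ∈ K) → opNorm x ≤ C * twoNorm x) :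
    ConvolutionBound K C := by
  intro X Y Z hXK
  rcases K.eq_empty_or_nonempty with rfl | hK
  · simp [Function.support_eq_empty_iff.1 (Set.subset_empty_iff.1 hXK)]
  have C_ne_zero : (C : ℝ≥0∞) ≠ 0 := by
    exact_mod_cast (zero_lt_one.trans_le (one_le_of_forall_opNorm_le hK h)).ne'
  by_cases h0 : l2norm X * l2norm Y * l2norm Z = 0
  · simp [tsum_tsum_mul_eq_zero h0]
  by_cases htop : l2norm X * l2norm Y * l2norm Z = ∞
  · simp [htop, ENNReal.mul_top C_ne_zero]
  have hX : l2norm X ≠ ∞ := fun hX => by simp_all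
  have hY : l2norm Y ≠ ∞ := fun hY => by simp_all
  lift X to G → ℝ≥0 using fun s => ne_top_of_le_ne_top hX (le_l2norm X s)
  lift Y to G → ℝ≥0 using fun t => ne_top_of_le_ne_top hY (le_l2norm Y t)
  rw [ENNReal.tsum_eq_iSup_sum]
  exact iSup_le <| sum_tsum_mul_le_of_forall_opNorm_le h
    (fun s hs => hXK (by simpa using hs)) hY Z

theorem HasSD.convolutionBound {l : G → ℝ≥0} {f : ℕ → ℝ≥0} (h : HasSD l f) (D : ℕ) :
    ConvolutionBound {g | l g ≤ D} (f D) :=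
  convolutionBound_of_forall_opNorm_le (h.decay D)

theorem HasSD.one_le {l : G → ℝ≥0} {f : ℕ → ℝ≥0} (h : HasSD l f) (D : ℕ) : 1 ≤ f D :=
  one_le_of_forall_opNorm_le (K := {g | l g ≤ D}) ⟨1, by simp [h.isLength.map_one]⟩ (h.decay D)

theorem ConvolutionBound.tsum_amplified_le {α β γ : Type*} {C : ℝ≥0∞} (h : ConvolutionBound K C)
    (A : (α × β) × G → ℝ≥0∞) (B : (β × γ) × G → ℝ≥0∞) (E : (α × γ) × G → ℝ≥0∞)
    (hA : ∀ p, A p ≠ 0 → p.2 ∈ K) :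
    ∑' (a) (b) (c) (s) (t), A ((a, b), s) * B ((b, c), t) * E ((a, c), s * t)
      ≤ C * (l2norm A * l2norm B * l2norm E) := by
  calc ∑' (a) (b) (c) (s) (t), A ((a, b), s) * B ((b, c), t) * E ((a, c), s * t)
      ≤ ∑' (a) (b) (c), C * (l2norm (fun s => A ((a, b), s)) * l2norm (fun t => B ((b, c), t))
          * l2norm (fun r => E ((a, c), r))) := by
        gcongr with a b c
        exact h _ _ (fun r => E ((a, c), r)) fun s hs => hA _ hs
    _ = C * ∑' (a) (b) (c), l2norm (fun s => A ((a, b), s)) * l2norm (fun t => B ((b, c), t))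
          * l2norm (fun r => E ((a, c), r)) := by
        simp_rw [ENNReal.tsum_mul_left]
    _ ≤ C * (l2norm A * l2norm B * l2norm E) := by
        rw [← l2norm_l2norm A, ← l2norm_l2norm B, ← l2norm_l2norm E]
        gcongr
        exact tsum_triangle_le (fun p => l2norm fun s => A (p, s))
          (fun p => l2norm fun s => B (p, s)) fun p => l2norm fun s => E (p, s)

end Convolution

section Words

variable {G H : Type*}

/-- The sum of the lengths of the letters of a word, reduced or not. -/
def wordLength (lG : G → ℝ≥0) (lH : H → ℝ≥0) (w : List (G ⊕ H)) : ℝ≥0 :=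
  (w.map (Sum.elim lG lH)).sum

variable {lG : G → ℝ≥0} {lH : H → ℝ≥0}

@[simp] theorem wordLength_append (a b : List (G ⊕ H)) :
    wordLength lG lH (a ++ b) = wordLength lG lH a + wordLength lG lH b := by
  simp [wordLength]

theorem letter_le_wordLength {s : G ⊕ H} {w : List (G ⊕ H)} (hs : s ∈ w) :
    Sum.elim lG lH s ≤ wordLength lG lH w :=
  List.single_le_sum (fun _ _ => zero_le) _ (List.mem_map_of_mem hs)

variable [Group G] [Group H]

theorem reducedWord_wordProd {w : List (G ⊕ H)} (hw : IsReduced w) :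
    reducedWord (wordProd w) = w :=
  reduced_unique (reducedWord_spec _).1 hw (reducedWord_spec _).2

@[simp] theorem wordProd_append (a b : List (G ⊕ H)) :
    wordProd (a ++ b) = wordProd a * wordProd b := by simp [wordProd]

/-- The formal inverse of a word: inverses of the letters in reverse order. -/
def invWord (w : List (G ⊕ H)) : List (G ⊕ H) :=
  (w.map (Sum.map (·⁻¹) (·⁻¹))).reverse

@[simp] theorem invWord_append (a b : List (G ⊕ H)) :
    invWord (a ++ b) = invWord b ++ invWord a := by simp [invWord]

@[simp] theorem length_invWord (w : List (G ⊕ H)) : (invWord w).length = w.length := by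
  simp [invWord]

theorem invWord_invWord (w : List (G ⊕ H)) : invWord (invWord w) = w := by
  simp [invWord, List.map_reverse, Function.comp_def]

theorem invWord_injective : Function.Injective (invWord : List (G ⊕ H) → List (G ⊕ H)) :=
  Function.LeftInverse.injective invWord_invWord

@[simp] theorem wordProd_invWord (w : List (G ⊕ H)) : wordProd (invWord w) = (wordProd w)⁻¹ := by
  have inv_letter : (Sum.elim (fun g => .inl g) fun h => .inr h) ∘ Sum.map (·⁻¹) (·⁻¹)
      = (·⁻¹) ∘ (Sum.elim (fun g => .inl g) fun h => .inr h : G ⊕ H → Monoid.Coprod G H) := by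
    ext (g | h) <;> simp
  rw [wordProd, wordProd, List.prod_inv_reverse, invWord, List.map_reverse, List.map_map,
    List.map_map, inv_letter]

theorem IsReduced.of_append_left {a b : List (G ⊕ H)} (h : IsReduced (a ++ b)) : IsReduced a :=
  ⟨fun s hs => h.1 s (List.mem_append_left b hs), h.2.left_of_append⟩

theorem IsReduced.of_append_right {a b : List (G ⊕ H)} (h : IsReduced (a ++ b)) : IsReduced b :=
  ⟨fun s hs => h.1 s (List.mem_append_right a hs), h.2.right_of_append⟩

theorem isReduced_invWord {w : List (G ⊕ H)} (h : IsReduced w) : IsReduced (invWord w) := by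
  refine ⟨fun s hs => ?_, ?_⟩
  · simp only [invWord, List.mem_reverse, List.mem_map] at hs
    obtain ⟨t, ht, rfl⟩ := hs
    rcases t with g | g <;> simpa using h.1 _ ht
  · rw [invWord, List.isChain_reverse, List.isChain_map]
    refine h.2.imp fun s t hst => ?_
    simpa using hst.symm

theorem IsReduced.glue {a c : List (G ⊕ H)} {s t r : G ⊕ H} (ha : IsReduced (a ++ [s]))
    (hc : IsReduced (t :: c)) (hs : s.isLeft = r.isLeft) (ht : t.isLeft = r.isLeft)
    (hr : r ≠ Sum.inl 1 ∧ r ≠ Sum.inr 1) : IsReduced (a ++ [r] ++ c) := by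
  refine ⟨fun x hx => ?_, ?_⟩
  · simp only [List.mem_append, List.mem_singleton] at hx
    rcases hx with (hx | rfl) | hx
    · exact ha.1 x (List.mem_append_left _ hx)
    · exact hr
    · exact hc.1 x (List.mem_cons_of_mem t hx)
  · have left_chain := ha.2
    have right_chain := hc.2
    rw [← List.isChain_map (R := (· ≠ ·)) Sum.isLeft] at left_chain right_chain ⊢
    simp only [List.map_append, List.map_cons, List.map_nil, List.append_assoc,
      List.singleton_append, hs, ht] at left_chain right_chain ⊢
    exact List.isChain_split.2 ⟨left_chain, right_chain⟩

theorem IsReduced.append_of_isLeft_ne {a c : List (G ⊕ H)} {s t : G ⊕ H}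
    (ha : IsReduced (a ++ [s])) (hc : IsReduced (t :: c)) (hst : s.isLeft ≠ t.isLeft) :
    IsReduced (a ++ [s] ++ t :: c) := by
  refine ⟨fun x hx => (List.mem_append.1 hx).elim (ha.1 x) (hc.1 x), ?_⟩
  rw [List.append_assoc, List.singleton_append]
  exact List.isChain_split.2 ⟨ha.2, List.isChain_cons_cons.2 ⟨hst, hc.2⟩⟩

/-- `IsMerge p q r` says that `r` is what remains at the place where the cancellation in a product
of reduced words stops: either nothing is left between the two words (all of `p`, `q`, `r` are
empty), or two letters from the same factor are multiplied. -/
inductive IsMerge : List (G ⊕ H) → List (G ⊕ H) → List (G ⊕ H) → Prop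
  | nil : IsMerge [] [] []
  | inl (s t : G) : IsMerge [.inl s] [.inl t] [.inl (s * t)]
  | inr (s t : H) : IsMerge [.inr s] [.inr t] [.inr (s * t)]

theorem IsMerge.wordProd_eq {p q r : List (G ⊕ H)} (h : IsMerge p q r) :
    wordProd r = wordProd p * wordProd q := by
  cases h <;> simp [wordProd]

theorem IsReduced.exists_cancellation {u v : List (G ⊕ H)} (hu : IsReduced u) (hv : IsReduced v) :
    ∃ a b c p q r, IsMerge p q r ∧ u = a ++ p ++ b ∧ v = invWord b ++ q ++ c ∧
      IsReduced (a ++ r ++ c) := by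
  induction u using List.reverseRecOn generalizing v with
  | nil => exact ⟨[], [], v, [], [], [], .nil, rfl, rfl, hv⟩
  | append_singleton u s ih =>
    rcases v with _ | ⟨t, v⟩
    · exact ⟨u ++ [s], [], [], [], [], [], .nil, by simp, rfl, by simpa using hu⟩
    by_cases cancels : t = Sum.map (·⁻¹) (·⁻¹) s
    · obtain ⟨a, b, c, p, q, r, hm, rfl, rfl, hr⟩ :=
        ih hu.of_append_left (hv.of_append_right (a := [t]))
      exact ⟨a, b ++ [s], c, p, q, r, hm, by simp, by simp [invWord, cancels], hr⟩
    by_cases same_factor : s.isLeft = t.isLeft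
    · rcases s with s | s <;> rcases t with t | t
      · refine ⟨u, [], v, _, _, _, .inl s t, by simp, by simp [invWord], hu.glue hv rfl rfl ?_⟩
        simpa [mul_eq_one_iff_eq_inv', eq_comm] using cancels
      · simp at same_factor
      · simp at same_factor
      · refine ⟨u, [], v, _, _, _, .inr s t, by simp, by simp [invWord], hu.glue hv rfl rfl ?_⟩
        simpa [mul_eq_one_iff_eq_inv', eq_comm] using cancels
    · exact ⟨u ++ [s], [], t :: v, [], [], [], .nil, by simp, rfl,
        by simpa using hu.append_of_isLeft_ne hv same_factor⟩

theorem wordLength_invWord (hG : IsLength lG) (hH : IsLength lH) (w : List (G ⊕ H)) :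
    wordLength lG lH (invWord w) = wordLength lG lH w := by
  have length_inv : Sum.elim lG lH ∘ Sum.map (·⁻¹) (·⁻¹) = Sum.elim lG lH := by
    ext (g | h) <;> simp [hG.map_inv, hH.map_inv]
  rw [wordLength, wordLength, invWord, List.map_reverse, List.sum_reverse, List.map_map, length_inv]

theorem IsMerge.wordLength_le (hG : IsLength lG) (hH : IsLength lH) {p q r : List (G ⊕ H)}
    (h : IsMerge p q r) : wordLength lG lH r ≤ wordLength lG lH p + wordLength lG lH q := by
  cases h <;> simp [wordLength, hG.map_mul_le, hH.map_mul_le]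

theorem IsReduced.length_le_wordLength (hG : ∀ g : G, g ≠ 1 → 1 ≤ lG g)
    (hH : ∀ h : H, h ≠ 1 → 1 ≤ lH h) {w : List (G ⊕ H)} (hw : IsReduced w) :
    (w.length : ℝ≥0) ≤ wordLength lG lH w := by
  rw [← nsmul_one, ← List.length_map (Sum.elim lG lH)]
  refine List.card_nsmul_le_sum _ _ fun r hr => ?_
  obtain ⟨s, hs, rfl⟩ := List.mem_map.1 hr
  have not_one := hw.1 s hs
  rcases s with s | s
  · exact hG s (by simpa using not_one)
  · exact hH s (by simpa using not_one)

theorem isLength_freeProductLength (hG : IsLength lG) (hH : IsLength lH) :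
    IsLength (freeProductLength lG lH) where
  map_one := freeProductLength_wordProd lG lH (w := []) ⟨by simp, by simp⟩
  map_inv x := by
    obtain ⟨w, hw, rfl⟩ := exists_reduced x
    rw [← wordProd_invWord, freeProductLength_wordProd lG lH hw,
      freeProductLength_wordProd lG lH (isReduced_invWord hw)]
    exact wordLength_invWord hG hH w
  map_mul_le x y := by
    obtain ⟨u, hu, rfl⟩ := exists_reduced x
    obtain ⟨v, hv, rfl⟩ := exists_reduced y
    obtain ⟨a, b, c, p, q, r, hm, rfl, rfl, hr⟩ := hu.exists_cancellation hv
    have prod_eq : wordProd (a ++ p ++ b) * wordProd (invWord b ++ q ++ c)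
        = wordProd (a ++ r ++ c) := by
      simp [hm.wordProd_eq, mul_assoc]
    simp only [prod_eq, freeProductLength_wordProd, hr, hu, hv]
    change wordLength lG lH _ ≤ wordLength lG lH _ + wordLength lG lH _
    simp only [wordLength_append, wordLength_invWord hG hH]
    calc wordLength lG lH a + wordLength lG lH r + wordLength lG lH c
        ≤ wordLength lG lH a + (wordLength lG lH p + wordLength lG lH q) + wordLength lG lH c
          + 2 * wordLength lG lH b := le_add_right (by gcongr; exact hm.wordLength_le hG hH)
      _ = _ := by ring

end Words

section WordSums

variable {G H Γ : Type*}

theorem tsum_le_tsum_of_exists_preimage {α β : Type*} {φ : α → ℝ≥0∞} {ψ : β → ℝ≥0∞} (π : β → α)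
    (h : ∀ a, ∃ b, π b = a ∧ φ a ≤ ψ b) : ∑' a, φ a ≤ ∑' b, ψ b := by
  choose i hi hφ using h
  exact (ENNReal.tsum_le_tsum hφ).trans
    (ENNReal.tsum_comp_le_tsum_of_injective (Function.LeftInverse.injective hi) ψ)

/-- A function on words as a function of splittings `σ a ++ m s ++ c` of a word, with fewer than
`N` letters in `a`. A word has at most one such splitting for each length of `a`. -/
noncomputable def splittings {α : Type*} (σ : List α → List α) (m : Γ → List α) (N : ℕ)
    (X : List α → ℝ≥0∞) : (List α × List α) × Γ → ℝ≥0∞ :=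
  {p : (List α × List α) × Γ | p.1.1.length < N}.indicator
    (X ∘ fun p => σ p.1.1 ++ m p.2 ++ p.1.2)

theorem l2norm_splittings_le {α : Type*} {σ : List α → List α} (hσ : Function.Injective σ)
    (hσ_length : ∀ a, (σ a).length = a.length) {m : Γ → List α} (hm : Function.Injective m) {k : ℕ}
    (hm_length : ∀ s, (m s).length = k) (N : ℕ) (X : List α → ℝ≥0∞) :
    l2norm (splittings σ m N X) ≤ (N : ℝ≥0∞) ^ (1 / 2 : ℝ) * l2norm X := by
  refine l2norm_indicator_comp_le _ _ (fun p p' h => ?_) N X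
  obtain ⟨length_eq, word_eq⟩ := Prod.mk.inj h
  obtain ⟨initial_eq, final_eq⟩ :=
    List.append_inj word_eq (by simp [hσ_length, hm_length, length_eq])
  obtain ⟨left_eq, middle_eq⟩ := List.append_inj initial_eq (by simp [hσ_length, length_eq])
  exact Prod.ext (Prod.ext (hσ left_eq) final_eq) (hm middle_eq)

variable [Group G] [Group H] [Group Γ]

/-- A function on the free product as a function on words, supported on reduced words. -/
noncomputable def onWords (x : Monoid.Coprod G H → ℝ≥0∞) : List (G ⊕ H) → ℝ≥0∞ :=
  {w | IsReduced w}.indicator (x ∘ wordProd)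

theorem onWords_of_isReduced (x : Monoid.Coprod G H → ℝ≥0∞) {w : List (G ⊕ H)}
    (h : IsReduced w) : onWords x w = x (wordProd w) :=
  Set.indicator_of_mem (s := {w | IsReduced w}) h _

theorem l2norm_onWords_le (x : Monoid.Coprod G H → ℝ≥0∞) : l2norm (onWords x) ≤ l2norm x :=
  l2norm_indicator_comp_le_of_injOn (fun _ hu _ hv h => reduced_unique hu hv h) x

/-- The term of a glued product in which the middle pieces `m s` and `m t` of two words merge to
`m (s * t)` after the cancellation of `b`. The index is `(a, b, c, s, t)`. -/
noncomputable def glueTerm (m : Γ → List (G ⊕ H)) (X Y Z : List (G ⊕ H) → ℝ≥0∞) :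
    List (G ⊕ H) × List (G ⊕ H) × List (G ⊕ H) × Γ × Γ → ℝ≥0∞
  | (a, b, c, s, t) => X (a ++ m s ++ b) * Y (invWord b ++ m t ++ c) * Z (a ++ m (s * t) ++ c)

/-- The elements represented by the two words that are multiplied in a `glueTerm`. -/
def gluePair (m : Γ → List (G ⊕ H)) :
    List (G ⊕ H) × List (G ⊕ H) × List (G ⊕ H) × Γ × Γ → Monoid.Coprod G H × Monoid.Coprod G H
  | (a, b, c, s, t) => (wordProd (a ++ m s ++ b), wordProd (invWord b ++ m t ++ c))

theorem tsum_tsum_le_tsum_glueTerm (x y z : Monoid.Coprod G H → ℝ≥0∞) :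
    ∑' (g) (h), x g * y h * z (g * h)
      ≤ ∑' i, glueTerm (fun _ : Unit => []) (onWords x) (onWords y) (onWords z) i
      + (∑' i, glueTerm (fun s : G => [.inl s]) (onWords x) (onWords y) (onWords z) i
      + ∑' i, glueTerm (fun s : H => [.inr s]) (onWords x) (onWords y) (onWords z) i) := by
  let ψ := Sum.elim (glueTerm (fun _ : Unit => []) (onWords x) (onWords y) (onWords z))
    (Sum.elim (glueTerm (fun s : G => [.inl s]) (onWords x) (onWords y) (onWords z))
      (glueTerm (fun s : H => [.inr s]) (onWords x) (onWords y) (onWords z)))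
  calc ∑' (g) (h), x g * y h * z (g * h)
      = ∑' p : Monoid.Coprod G H × Monoid.Coprod G H, x p.1 * y p.2 * z (p.1 * p.2) :=
        ENNReal.tsum_prod.symm
    _ ≤ ∑' i, ψ i := by
        refine tsum_le_tsum_of_exists_preimage (Sum.elim (gluePair fun _ : Unit => [])
          (Sum.elim (gluePair fun s => [.inl s]) (gluePair fun s => [.inr s]))) ?_
        rintro ⟨g, h⟩
        obtain ⟨u, hu, rfl⟩ := exists_reduced g
        obtain ⟨v, hv, rfl⟩ := exists_reduced h
        obtain ⟨a, b, c, p, q, r, hm, rfl, rfl, hr⟩ := hu.exists_cancellation hv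
        have term_eq : x (wordProd (a ++ p ++ b)) * y (wordProd (invWord b ++ q ++ c))
            * z (wordProd (a ++ p ++ b) * wordProd (invWord b ++ q ++ c))
            = onWords x (a ++ p ++ b) * onWords y (invWord b ++ q ++ c)
              * onWords z (a ++ r ++ c) := by
          rw [onWords_of_isReduced x hu, onWords_of_isReduced y hv, onWords_of_isReduced z hr]
          simp [hm.wordProd_eq, mul_assoc]
        cases hm with
        | nil => exact ⟨.inl (a, b, c, (), ()), rfl, term_eq.le⟩
        | inl s t => exact ⟨.inr (.inl (a, b, c, s, t)), rfl, term_eq.le⟩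
        | inr s t => exact ⟨.inr (.inr (a, b, c, s, t)), rfl, term_eq.le⟩
    _ = _ := by
        rw [Summable.tsum_sum ENNReal.summable ENNReal.summable,
          Summable.tsum_sum ENNReal.summable ENNReal.summable]
        rfl

theorem glueTerm_le_splittings {m : Γ → List (G ⊕ H)} {k : ℕ} (hm_length : ∀ s, (m s).length = k)
    {N : ℕ} {X : List (G ⊕ H) → ℝ≥0∞} (hX : ∀ w, X w ≠ 0 → w.length < N + k)
    (Y Z : List (G ⊕ H) → ℝ≥0∞) (a b c : List (G ⊕ H)) (s t : Γ) :
    glueTerm m X Y Z (a, b, c, s, t) ≤ splittings id m N X ((a, b), s)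
      * splittings invWord m N Y ((b, c), t) * splittings id m N Z ((a, c), s * t) := by
  by_cases h0 : X (a ++ m s ++ b) = 0
  · simp [glueTerm, h0, -List.append_assoc]
  have length_lt := hX _ h0
  simp only [List.length_append, hm_length] at length_lt
  have ha : a.length < N := by lia
  have hb : b.length < N := by lia
  simp [splittings, glueTerm, ha, hb]

theorem ConvolutionBound.tsum_glueTerm_le {K : Set Γ} {C : ℝ≥0∞} (hK : ConvolutionBound K C)
    {m : Γ → List (G ⊕ H)} (hm : Function.Injective m) {k : ℕ} (hm_length : ∀ s, (m s).length = k)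
    {N : ℕ} {X : List (G ⊕ H) → ℝ≥0∞} (hX : ∀ w, X w ≠ 0 → w.length < N + k)
    (hXK : ∀ a s b, X (a ++ m s ++ b) ≠ 0 → s ∈ K) (Y Z : List (G ⊕ H) → ℝ≥0∞) :
    ∑' i, glueTerm m X Y Z i
      ≤ C * (N : ℝ≥0∞) ^ (3 / 2 : ℝ) * (l2norm X * l2norm Y * l2norm Z) := by
  calc ∑' i, glueTerm m X Y Z i
      ≤ ∑' (a) (b) (c) (s) (t), splittings id m N X ((a, b), s)
          * splittings invWord m N Y ((b, c), t) * splittings id m N Z ((a, c), s * t) := by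
        simp_rw [ENNReal.tsum_prod']
        gcongr
        exact glueTerm_le_splittings hm_length hX _ _ _ _ _ _ _
    _ ≤ C * (l2norm (splittings id m N X) * l2norm (splittings invWord m N Y)
          * l2norm (splittings id m N Z)) := by
        refine hK.tsum_amplified_le _ _ _ fun p hp => hXK p.1.1 p.2 p.1.2 fun h0 => hp ?_
        simp [splittings, Set.indicator_apply, h0, -List.append_assoc]
    _ ≤ C * (((N : ℝ≥0∞) ^ (1 / 2 : ℝ) * l2norm X) * ((N : ℝ≥0∞) ^ (1 / 2 : ℝ) * l2norm Y)
          * ((N : ℝ≥0∞) ^ (1 / 2 : ℝ) * l2norm Z)) := by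
        gcongr
        · exact l2norm_splittings_le Function.injective_id (fun _ => rfl) hm hm_length N X
        · exact l2norm_splittings_le invWord_injective length_invWord hm hm_length N Y
        · exact l2norm_splittings_le Function.injective_id (fun _ => rfl) hm hm_length N Z
    _ = C * ((N : ℝ≥0∞) ^ (1 / 2 : ℝ)) ^ 3 * (l2norm X * l2norm Y * l2norm Z) := by ring
    _ = _ := by
        rw [← ENNReal.rpow_natCast, ← ENNReal.rpow_mul]
        norm_num

/-- The elements of `G * H` whose reduced word has at most `n` letters, all of them in `K` or
`L`. -/
def wordBall (K : Set G) (L : Set H) (n : ℕ) : Set (Monoid.Coprod G H) :=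
  {x | (reducedWord x).length ≤ n ∧ ∀ s ∈ reducedWord x, Sum.elim (· ∈ K) (· ∈ L) s}

theorem ConvolutionBound.coprod {K : Set G} {L : Set H} {p q : ℝ≥0∞} (hK : ConvolutionBound K p)
    (hL : ConvolutionBound L q) (n : ℕ) :
    ConvolutionBound (wordBall K L n)
      (((n + 1 : ℕ) : ℝ≥0∞) ^ (3 / 2 : ℝ) + (p + q) * (n : ℝ≥0∞) ^ (3 / 2 : ℝ)) := by
  intro X Y Z hX
  have mem_wordBall (w : List (G ⊕ H)) (hw : onWords X w ≠ 0) :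
      w.length ≤ n ∧ ∀ s ∈ w, Sum.elim (· ∈ K) (· ∈ L) s := by
    obtain ⟨w_reduced, hXw⟩ := Set.indicator_apply_ne_zero.1 hw
    have := hX hXw
    rwa [wordBall, Set.mem_ofPred_eq, reducedWord_wordProd w_reduced] at this
  have length_lt (w : List (G ⊕ H)) (hw : onWords X w ≠ 0) : w.length < n + 1 :=
    Nat.lt_succ_of_le (mem_wordBall w hw).1
  calc ∑' (g) (h), X g * Y h * Z (g * h)
      ≤ _ := tsum_tsum_le_tsum_glueTerm X Y Z
    _ ≤ 1 * ((n + 1 : ℕ) : ℝ≥0∞) ^ (3 / 2 : ℝ)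
          * (l2norm (onWords X) * l2norm (onWords Y) * l2norm (onWords Z))
        + (p * (n : ℝ≥0∞) ^ (3 / 2 : ℝ)
          * (l2norm (onWords X) * l2norm (onWords Y) * l2norm (onWords Z))
        + q * (n : ℝ≥0∞) ^ (3 / 2 : ℝ)
          * (l2norm (onWords X) * l2norm (onWords Y) * l2norm (onWords Z))) := by
        gcongr
        · exact convolutionBound_univ_of_subsingleton.tsum_glueTerm_le
            (Function.injective_of_subsingleton _) (fun _ => rfl) length_lt (by simp) _ _
        · exact hK.tsum_glueTerm_le (m := fun s : G => [.inl s])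
            (fun s t h => by simpa using h) (fun _ => rfl) length_lt
            (fun a s b h => (mem_wordBall _ h).2 (.inl s) (by simp)) _ _
        · exact hL.tsum_glueTerm_le (m := fun s : H => [.inr s])
            (fun s t h => by simpa using h) (fun _ => rfl) length_lt
            (fun a s b h => (mem_wordBall _ h).2 (.inr s) (by simp)) _ _
    _ = (((n + 1 : ℕ) : ℝ≥0∞) ^ (3 / 2 : ℝ) + (p + q) * (n : ℝ≥0∞) ^ (3 / 2 : ℝ))
          * (l2norm (onWords X) * l2norm (onWords Y) * l2norm (onWords Z)) := by ring
    _ ≤ _ := by gcongr <;> exact l2norm_onWords_le _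

end WordSums

section Subexponential

variable {f g : ℕ → ℝ≥0}

theorem IsSubexp.mul (hf : IsSubexp f) (hg : IsSubexp g) : IsSubexp fun n => f n * g n := by
  simpa only [IsSubexp, NNReal.mul_rpow, mul_one] using Filter.Tendsto.mul hf hg

protected theorem IsSubexp.max (hf : IsSubexp f) (hg : IsSubexp g) :
    IsSubexp fun n => max (f n) (g n) := by
  have rpow_max (n : ℕ) : max (f n ^ (1 / (n : ℝ))) (g n ^ (1 / (n : ℝ)))
      = max (f n) (g n) ^ (1 / (n : ℝ)) :=
    ((NNReal.monotone_rpow_of_nonneg (by positivity)).map_max).symm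
  simpa only [IsSubexp, rpow_max, max_self] using Filter.Tendsto.max hf hg

theorem IsSubexp.rpow (hf : IsSubexp f) (e : ℝ) : IsSubexp fun n => f n ^ e := by
  have h := Filter.Tendsto.nnrpow hf (tendsto_const_nhds (x := e)) (.inl one_ne_zero)
  simpa only [IsSubexp, NNReal.one_rpow, ← NNReal.rpow_mul, mul_comm] using h

theorem isSubexp_linear {a : ℝ≥0} (ha : a ≠ 0) (b : ℝ≥0) : IsSubexp fun n : ℕ => a * n + b := by
  have ha' : (a : ℝ) ≠ 0 := by exact_mod_cast ha
  have linear_atTop : Filter.Tendsto (fun n : ℕ => (a * n + b : ℝ)) Filter.atTop Filter.atTop :=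
    Filter.tendsto_atTop_add_const_right _ _
      (tendsto_natCast_atTop_atTop.const_mul_atTop (by positivity))
  rw [IsSubexp, ← NNReal.tendsto_coe]
  refine ((tendsto_rpow_div_mul_add a 1 (-b) zero_ne_one).comp linear_atTop).congr fun n => ?_
  have exponent_eq : (a : ℝ) / (1 * (a * n + b) + -b) = 1 / n := by
    rw [one_mul, add_neg_cancel_right, div_mul_cancel_left₀ ha', one_div]
  simp only [Function.comp_apply, exponent_eq, NNReal.coe_rpow, NNReal.coe_add, NNReal.coe_mul,
    NNReal.coe_natCast]

end Subexponential

section TruncatedLength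

variable {G : Type*} [Group G] {l : G → ℝ≥0}

open scoped Classical in
/-- The length function `max l 1` off the identity. Replacing `l` by it makes the number of letters
of a reduced word at most the length of the word. -/
noncomputable def truncatedLength (l : G → ℝ≥0) (g : G) : ℝ≥0 :=
  if g = 1 then 0 else max (l g) 1

theorem one_le_truncatedLength (g : G) (hg : g ≠ 1) : 1 ≤ truncatedLength l g := by
  simp [truncatedLength, hg]

theorem IsLength.le_truncatedLength (hl : IsLength l) (g : G) : l g ≤ truncatedLength l g := by
  by_cases hg : g = 1 <;> simp [truncatedLength, hg, hl.map_one]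

protected theorem IsLength.truncatedLength (hl : IsLength l) : IsLength (truncatedLength l) where
  map_one := by simp [truncatedLength]
  map_inv g := by by_cases hg : g = 1 <;> simp [truncatedLength, hg, hl.map_inv]
  map_mul_le g k := by
    by_cases hg : g = 1
    · simp [hg]
    by_cases hk : k = 1
    · simp [hk]
    by_cases hgk : g * k = 1
    · simp [hgk, truncatedLength]
    simp only [truncatedLength, hg, hk, hgk, if_false]
    refine max_le ((hl.map_mul_le g k).trans ?_) (le_add_right (le_max_right _ _))
    gcongr <;> exact le_max_left _ _

theorem HasSD.of_le_length {f : ℕ → ℝ≥0} (h : HasSD l f) {l' : G → ℝ≥0} (hl' : IsLength l')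
    (hle : ∀ g, l g ≤ l' g) : HasSD l' f :=
  ⟨h.countable, hl', h.isSubexp, fun D x hx => h.decay D x fun g hg => (hle g).trans (hx g hg)⟩

protected theorem HasSD.truncatedLength {f : ℕ → ℝ≥0} (h : HasSD l f) :
    HasSD (truncatedLength l) f :=
  h.of_le_length h.isLength.truncatedLength h.isLength.le_truncatedLength

end TruncatedLength

section FreeProductDecay

variable {G H : Type*} [Group G] [Group H]

theorem rpow_add_mul_rpow_le_mul_max {p q : ℝ≥0} (h : 1 ≤ max p q) {e : ℝ} (he : 2 ≤ e) (n : ℕ) :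
    ((n + 1 : ℕ) : ℝ≥0) ^ (3 / 2 : ℝ) + (p + q) * (n : ℝ≥0) ^ (3 / 2 : ℝ)
      ≤ (2 * (n : ℝ≥0) + 1) ^ e * max p q := by
  have rpow_le_sq (m : ℕ) : (m : ℝ≥0) ^ (3 / 2 : ℝ) ≤ (m : ℝ≥0) ^ 2 := by
    rcases m.eq_zero_or_pos with rfl | hm
    · simp
    · rw [← NNReal.rpow_ofNat]
      exact NNReal.rpow_le_rpow_of_exponent_le (by exact_mod_cast hm) (by norm_num)
  calc ((n + 1 : ℕ) : ℝ≥0) ^ (3 / 2 : ℝ) + (p + q) * (n : ℝ≥0) ^ (3 / 2 : ℝ)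
      ≤ ((n + 1 : ℕ) : ℝ≥0) ^ 2 * max p q + (max p q + max p q) * (n : ℝ≥0) ^ 2 := by
        gcongr ?_ + (?_ + ?_) * ?_
        · exact (rpow_le_sq _).trans (le_mul_of_one_le_right zero_le h)
        · exact le_max_left p q
        · exact le_max_right p q
        · exact rpow_le_sq n
    _ = (((n + 1 : ℕ) : ℝ≥0) ^ 2 + 2 * (n : ℝ≥0) ^ 2) * max p q := by ring
    _ ≤ (2 * (n : ℝ≥0) + 1) ^ e * max p q := by
        gcongr
        calc ((n + 1 : ℕ) : ℝ≥0) ^ 2 + 2 * (n : ℝ≥0) ^ 2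
            ≤ ((n + 1 : ℕ) : ℝ≥0) ^ 2 + 2 * (n : ℝ≥0) ^ 2 + (n ^ 2 + 2 * n) := le_self_add
          _ = (2 * (n : ℝ≥0) + 1) ^ 2 := by
              push_cast
              ring
          _ ≤ (2 * (n : ℝ≥0) + 1) ^ e := by
              rw [← NNReal.rpow_ofNat]
              exact NNReal.rpow_le_rpow_of_exponent_le le_add_self he

theorem countable_coprod [Countable G] [Countable H] : Countable (Monoid.Coprod G H) :=
  Function.Surjective.countable fun x => ⟨reducedWord x, (reducedWord_spec x).2⟩

variable {lG : G → ℝ≥0} {lH : H → ℝ≥0}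

theorem mem_wordBall_of_freeProductLength_le (hG : ∀ g : G, g ≠ 1 → 1 ≤ lG g)
    (hH : ∀ h : H, h ≠ 1 → 1 ≤ lH h) {D : ℕ} {x : Monoid.Coprod G H}
    (hx : freeProductLength lG lH x ≤ D) :
    x ∈ wordBall {g | lG g ≤ D} {h | lH h ≤ D} D := by
  change wordLength lG lH (reducedWord x) ≤ D at hx
  refine ⟨?_, fun s hs => ?_⟩
  · exact_mod_cast ((reducedWord_spec x).1.length_le_wordLength hG hH).trans hx
  · have letter_le := (letter_le_wordLength hs).trans hx
    rcases s with g | h <;> exact letter_le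

theorem HasSD.freeProduct {fG fH : ℕ → ℝ≥0} (hG : HasSD lG fG) (hH : HasSD lH fH)
    (one_le_lG : ∀ g : G, g ≠ 1 → 1 ≤ lG g) (one_le_lH : ∀ h : H, h ≠ 1 → 1 ≤ lH h)
    {e : ℝ} (he : 2 ≤ e) :
    HasSD (freeProductLength lG lH)
      (fun x : ℕ => (2 * (x : ℝ≥0) + 1) ^ e * max (fG x) (fH x)) where
  countable := by
    have := hG.countable
    have := hH.countable
    exact countable_coprod
  isLength := isLength_freeProductLength hG.isLength hH.isLength
  isSubexp := ((isSubexp_linear two_ne_zero 1).rpow e).mul (hG.isSubexp.max hH.isSubexp)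
  decay D x hx := by
    have coeff_le := rpow_add_mul_rpow_le_mul_max (le_max_of_le_left (hG.one_le D)) he D
      (q := fH D)
    have wordBall_bound := (hG.convolutionBound D).coprod (hH.convolutionBound D) D
    refine (wordBall_bound.mono subset_rfl ?_).opNorm_le fun g hg =>
      mem_wordBall_of_freeProductLength_le one_le_lG one_le_lH (hx g hg)
    simp only [← ENNReal.coe_natCast]
    rw [← ENNReal.coe_rpow_of_nonneg _ (by norm_num), ← ENNReal.coe_rpow_of_nonneg _ (by norm_num)]
    exact_mod_cast coeff_le

end FreeProductDecay

end SubexpDecay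

theorem mainTheorem9_general {G H : Type*} [Group G] [Group H]
    (lG : G → ℝ≥0) (lH : H → ℝ≥0) (fG fH : ℕ → ℝ≥0)
    (hG : SubexpDecay.HasSD lG fG) (hH : SubexpDecay.HasSD lH fH) {e : ℝ} (he : 2 ≤ e) :
    (∃ l : Monoid.Coprod G H → ℝ≥0,
      SubexpDecay.HasSD l
        (fun x : ℕ => (2 * (x : ℝ≥0) + 1) ^ e * max (fG x) (fH x))) ∧
    ((∀ g : G, g ≠ 1 → 1 ≤ lG g) → (∀ h : H, h ≠ 1 → 1 ≤ lH h) →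
      SubexpDecay.HasSD (SubexpDecay.freeProductLength lG lH)
        (fun x : ℕ => (2 * (x : ℝ≥0) + 1) ^ e * max (fG x) (fH x))) :=
  ⟨⟨_, hG.truncatedLength.freeProduct hH.truncatedLength SubexpDecay.one_le_truncatedLength
    SubexpDecay.one_le_truncatedLength he⟩, fun one_le_lG one_le_lH =>
      hG.freeProduct hH one_le_lG one_le_lH he⟩

theorem mainTheorem9 {G H : Type*} [Group G] [Group H]
    (lG : G → ℝ≥0) (lH : H → ℝ≥0) (fG fH : ℕ → ℝ≥0)
    (hG : SubexpDecay.HasSD lG fG) (hH : SubexpDecay.HasSD lH fH) :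
    (∃ l : Monoid.Coprod G H → ℝ≥0,
      SubexpDecay.HasSD l
        (fun x : ℕ => (2 * (x : ℝ≥0) + 1) ^ (7 / 2 : ℝ) * max (fG x) (fH x))) ∧
    ((∀ g : G, g ≠ 1 → 1 ≤ lG g) → (∀ h : H, h ≠ 1 → 1 ≤ lH h) →
      SubexpDecay.HasSD (SubexpDecay.freeProductLength lG lH)
        (fun x : ℕ => (2 * (x : ℝ≥0) + 1) ^ (7 / 2 : ℝ) * max (fG x) (fH x))) :=
  mainTheorem9_general lG lH fG fH hG hH (by norm_num)
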